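/- **Semi-online bipartite matching.** The input graph $G$ is a finite bipartite graph with a set $U$ of offline nodes and a set $V = V_P \sqcup V_A$ of online nodes, where the nodes of $V_P$ are called predicted and those of $V_A$ adversarial. The predicted graph $H$ is the subgraph of $G$ induced on $U \cup V_P$. The algorithm knows $H$ in advance. The nodes of $V$ then arrive one at a time, in an arbitrary order that may interleave $V_P$ and $V_A$; each is revealed through its set of neighbours in $U$ only, and must at once be irrevocably matched to a neighbour in $U$ that is not yet matched, or be abandoned. $G$ and the order of arrival do not depend on the random choices of the algorithm. Let $\nu(\cdot)$ be the maximum size of a matching and $\delta = 1 - \nu(H)/\nu(G)$. (If $G$ has a perfect matching and $n = |U| = |V| \ge 1$, then $\delta = |V_A|/n$.) **Iterative Sampling.** *Preprocessing.* Let $d = |U| - |V_P|$ and $H_0 = H$. For $i = 1, \dots, d$, draw $u_i$ uniformly at random among the nodes $u \in U \setminus \{u_1, \dots, u_{i-1}\}$ with $\nu(H_{i-1} \setminus \{u\}) = |V_P|$, and let $H_i = H_{i-1} \setminus \{u_i\}$ (if there is no such node, which does not happen if $G$ has a perfect matching, the drawing stops). Take an arbitrary maximum matching $M$ in the last graph obtained,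 and let $R$ be a uniformly random ordering of the drawn nodes. *Online phase.* If the arriving node has the same neighbours as a predicted node that has not been seen before, treat it as such a predicted node $v$ and match it to its partner $M(v)$ (abandon it if $v$ is not covered by $M$). Otherwise treat it as adversarial and match it to its first neighbour in $R$ that is not yet matched, if there is one (RANKING), and abandon it if there is none. **Theorem.** Iterative Sampling, with any rule for the choice of the maximum matching $M$ given $H$ and $(u_1, \dots, u_d)$, is a randomized algorithm for semi-online bipartite matching: it always matches nodes to neighbours of theirs and never uses an offline node twice. Whenever $G$ has a perfect matching, its expected competitive ratio is at least $1 - \delta + \frac{\delta^2}{2}\left(1 - \frac1e\right)$; that is, for every order of arrival, the expected number of online nodes that it matches is at least $$\left(1 - \delta + \frac{\delta^2}{2}\Bigl(1 - \frac1e\Bigr)\right)\nu(G).$$ -/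

import Mathlib

open scoped ENNReal

namespace SemiOnline

/-! A bipartite graph with offline side `U` and online side `V` is given by the neighbourhoods
`Γ v` of the online nodes `v : V`. -/

section Matchings

variable {U V : Type*}

/-- `M` is a matching: a set of edges, no two of which share an endpoint. -/
def IsMatching (Γ : V → Finset U) (M : Finset (V × U)) : Prop :=
  (∀ e ∈ M, e.2 ∈ Γ e.1) ∧
    Set.InjOn Prod.fst (M : Set (V × U)) ∧ Set.InjOn Prod.snd (M : Set (V × U))

open Classical in
/-- The matching number: the largest number of edges of a matching. -/
noncomputable def nu [Fintype U] [Fintype V] (Γ : V → Finset U) : ℕ :=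
  ((Finset.univ : Finset (Finset (V × U))).filter (IsMatching Γ)).sup Finset.card

/-- A matching of the largest possible size. -/
def IsMaximumMatching [Fintype U] [Fintype V] (Γ : V → Finset U) (M : Finset (V × U)) : Prop :=
  IsMatching Γ M ∧ M.card = nu Γ

/-- Every node, offline or online, is covered by one matching. -/
def HasPerfectMatching (Γ : V → Finset U) : Prop :=
  ∃ m : V ≃ U, ∀ v, m v ∈ Γ v

open Classical in
/-- The partner of the online node `v` in the matching `M`, if there is one. -/
noncomputable def partner (M : Finset (V × U)) (v : V) : Option U :=
  if h : ∃ u, (v, u) ∈ M then some h.choose else none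

/-- The graph with the offline nodes in the list `us` removed. -/
def remove [DecidableEq U] (Γ : V → Finset U) (us : List U) : V → Finset U :=
  fun v => Γ v \ us.toFinset

theorem exists_isMaximumMatching [Fintype U] [Fintype V] (Γ : V → Finset U) :
    ∃ M, IsMaximumMatching Γ M := by
  classical
  obtain ⟨M, hM, h⟩ := Finset.exists_mem_eq_sup
    ((Finset.univ : Finset (Finset (V × U))).filter (IsMatching Γ))
    ⟨∅, by simp [IsMatching]⟩ Finset.card
  refine ⟨M, (Finset.mem_filter.1 hM).2, ?_⟩
  rw [nu, h]

end Matchings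

section Model

variable {U P A : Type*}

/-- The predicted graph `H` of an input graph `G`, whose online nodes are the predicted nodes `P`
and the adversarial nodes `A`. -/
def predictedGraph (G : P ⊕ A → Finset U) : P → Finset U := fun p => G (Sum.inl p)

/-- `δ(G) = 1 - ν(H) / ν(G)`. -/
noncomputable def delta [Fintype U] [Fintype P] [Fintype A] (G : P ⊕ A → Finset U) : ℝ :=
  1 - (nu (predictedGraph G) : ℝ) / (nu G : ℝ)

/-- A deterministic rule for the online phase. It sees the neighbourhoods of the nodes revealed
earlier, in their order of arrival, and the neighbourhood of the node just revealed, but not the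
names of these nodes; it matches the new node to an offline node (`some u`) or abandons it
(`none`). -/
abbrev Policy (U : Type*) := List (Finset U) → Finset U → Option U

/-- The decisions of the rule `D` on a sequence of arrivals, when `past` arrived before. -/
def runFrom (D : Policy U) : List (Finset U) → List (Finset U) → List (Option U)
  | _, [] => []
  | past, N :: rest => D past N :: runFrom D (past ++ [N]) rest

/-- The decisions of the rule `D` on a sequence of arrivals. -/
def run (D : Policy U) (arrivals : List (Finset U)) : List (Option U) := runFrom D [] arrivals

/-- On every sequence of arrivals, nodes are matched only to neighbours of theirs, and no offline
node is used twice. -/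
def Legal (D : Policy U) : Prop :=
  ∀ arrivals : List (Finset U),
    List.Forall₂ (fun N o => ∀ u, o = some u → u ∈ N) arrivals (run D arrivals) ∧
      (run D arrivals).reduceOption.Nodup

/-- The number of online nodes that the rule `D` matches. -/
def matchedCount (D : Policy U) (arrivals : List (Finset U)) : ℕ :=
  (run D arrivals).reduceOption.length

/-- The expected number of online nodes matched by a rule drawn at random from `alg`. -/
noncomputable def expectedMatched (alg : PMF (Policy U)) (arrivals : List (Finset U)) : ℝ≥0∞ :=
  ∑' D, alg D * (matchedCount D arrivals : ℝ≥0∞)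

/-- The nodes of `V` are listed, each exactly once, in their order of arrival. -/
def IsArrivalOrder {V : Type*} (order : List V) : Prop :=
  order.Nodup ∧ ∀ v, v ∈ order

end Model

section Algorithm

variable {U P : Type*} [Fintype U] [DecidableEq U] [Fintype P] [DecidableEq P]

open Classical in
/-- The offline nodes, other than the removed nodes `us`, whose additional removal leaves a
matching that covers all predicted nodes. -/
noncomputable def candidates (H : P → Finset U) (us : List U) : Finset U :=
  Finset.univ.filter fun u => u ∉ us ∧ nu (remove H (us ++ [u])) = Fintype.card P

/-- Remove `k` further offline nodes, one after the other, each uniformly at random from the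
current candidates; `us` lists the nodes removed before. (If there is no candidate, which never
happens when `H` is part of a graph with a perfect matching and at most `|U| - |P|` nodes are
removed, the removal stops.) -/
noncomputable def reserve (H : P → Finset U) : ℕ → List U → PMF (List U)
  | 0, us => PMF.pure us
  | k + 1, us =>
      if h : (candidates H us).Nonempty then
        (PMF.uniformOfFinset (candidates H us) h).bind fun u => reserve H k (us ++ [u])
      else PMF.pure us

/-- A uniformly random reordering of a list. -/
noncomputable def randomOrder (us : List U) : PMF (List U) :=
  (PMF.uniformOfFintype (Equiv.Perm (Fin us.length))).map fun π =>
    List.ofFn fun i => us.get (π i)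

/-- The preprocessing phase: remove `d = |U| - |P|` random offline nodes, take the maximum matching
of the remaining graph that the rule `M` prescribes, and put the removed nodes in random order. -/
noncomputable def preprocess (H : P → Finset U) (M : List U → Finset (P × U)) :
    PMF (Finset (P × U) × List U) :=
  (reserve H (Fintype.card U - Fintype.card P) []).bind fun us =>
    (randomOrder us).map fun R => (M us, R)

open Classical in
/-- One step of the online phase. The state holds the predicted nodes not seen so far and the
unmatched reserved nodes, in their random order. A new node with neighbourhood `N` is taken for an
unseen predicted node with this neighbourhood, if there is one, and is matched to the partner of
the latter in `M`; otherwise it is matched to its first unmatched reserved neighbour, if there is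
one. -/
noncomputable def onlineStep (H : P → Finset U) (M : Finset (P × U))
    (s : Finset P × List U) (N : Finset U) : Option U × (Finset P × List U) :=
  if h : ∃ p, p ∈ s.1 ∧ H p = N then
    (partner M h.choose, (s.1.erase h.choose, s.2))
  else
    match s.2.find? (fun u => decide (u ∈ N)) with
    | some u => (some u, (s.1, s.2.erase u))
    | none => (none, s)

/-- The online phase for the matching `M` and the ordered list `R` of reserved nodes. -/
noncomputable def onlinePhase (H : P → Finset U) (M : Finset (P × U)) (R : List U) : Policy U :=
  fun past N =>
    (onlineStep H M (past.foldl (fun s N' => (onlineStep H M s N').2) (Finset.univ, R)) N).1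

/-- The Iterative Sampling algorithm on the predicted graph `H`. -/
noncomputable def iterativeSampling (H : P → Finset U) (M : List U → Finset (P × U)) :
    PMF (Policy U) :=
  (preprocess H M).map fun MR => onlinePhase H MR.1 MR.2

end Algorithm

end SemiOnline

set_option linter.unusedSectionVars false

/-! Fix a perfect matching `m` of `G`, let `n = |U|` and `d = |V_A|`, and let `T` be the set of the
`d` partners of the adversarial nodes. Only neighbourhoods are visible, so an adversarial node may
be mistaken for a predicted twin. Still, the arrivals treated as adversarial have, as a multiset,
exactly the neighbourhoods of `V_A` (`adversarialArrivals_add`). As `M` covers all predicted nodes,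
the algorithm matches `|V_P|` nodes plus those that RANKING matches into the reserve.

Two expectations remain. When `k` nodes are still to be drawn, at least `k` of the at most `n`
candidates lie in `T`: this is an exchange argument along alternating paths
(`le_card_candidates_inter`). Hence the reserve contains in expectation at least `(d + ... + 1) / n
= d (d + 1) / (2 n)` nodes of `T` (`le_expect_countP_reserve`). These nodes are covered by a
matching with adversarial arrivals, and RANKING achieves in expectation at least the fraction `1 -
(d / (d + 1)) ^ d` of its size (`le_expect_ranking`).

This fraction is below `1 - 1/e`, but the factor `d + 1` from the sampling, in place of `d`, makes
up for it (`mul_one_sub_exp_le`). The total is at least `|V_P| + d ^ 2 / (2 n) * (1 - 1/e)`, which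
is the claim, since `δ = d / n`. -/

namespace SemiOnline

/-! ### Matchings that cover all online nodes. -/

section MatchingNumber

variable {U V : Type*} [Fintype U] [Fintype V] {Γ : V → Finset U}

theorem IsMatching.card_le {M : Finset (V × U)} (h : IsMatching Γ M) :
    M.card ≤ Fintype.card V := by
  classical
  rw [← Finset.card_image_of_injOn h.2.1]
  exact Finset.card_le_univ _

theorem nu_le_card : nu Γ ≤ Fintype.card V := by
  obtain ⟨M, hM, h⟩ := exists_isMaximumMatching Γ
  exact h ▸ hM.card_le

theorem IsMatching.card_le_nu {M : Finset (V × U)} (h : IsMatching Γ M) : M.card ≤ nu Γ := by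
  classical
  exact Finset.le_sup (f := Finset.card) (Finset.mem_filter.2 ⟨Finset.mem_univ _, h⟩)

theorem IsMatching.exists_mem_of_card_eq {M : Finset (V × U)} (h : IsMatching Γ M)
    (hM : M.card = Fintype.card V) (v : V) : ∃ u, (v, u) ∈ M := by
  classical
  have h1 : M.image Prod.fst = Finset.univ := by
    rw [← Finset.card_eq_iff_eq_univ, Finset.card_image_of_injOn h.2.1, hM]
  have h2 : v ∈ M.image Prod.fst := h1 ▸ Finset.mem_univ v
  obtain ⟨⟨_, u⟩, h3, rfl⟩ := Finset.mem_image.1 h2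
  exact ⟨u, h3⟩

theorem nu_eq_card_iff :
    nu Γ = Fintype.card V ↔ ∃ f : V → U, Function.Injective f ∧ ∀ v, f v ∈ Γ v := by
  classical
  constructor
  · intro h
    obtain ⟨M, hM, hc⟩ := exists_isMaximumMatching Γ
    choose f hf using hM.exists_mem_of_card_eq (hc.trans h)
    refine ⟨f, fun v w hvw => ?_, fun v => hM.1 _ (hf v)⟩
    have h2 := hM.2.2 (Finset.mem_coe.2 (hf v)) (Finset.mem_coe.2 (hf w)) hvw
    exact congrArg Prod.fst h2
  · rintro ⟨f, hf, hΓ⟩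
    refine le_antisymm nu_le_card ?_
    have hM : IsMatching Γ (Finset.univ.image fun v => (v, f v)) := by
      refine ⟨by simpa using hΓ, ?_, ?_⟩
      · rintro _ h1 _ h2 h
        simp only [Finset.coe_image, Finset.coe_univ, Set.image_univ, Set.mem_range] at h1 h2
        obtain ⟨v, rfl⟩ := h1
        obtain ⟨w, rfl⟩ := h2
        simp_all
      · rintro _ h1 _ h2 h
        simp only [Finset.coe_image, Finset.coe_univ, Set.image_univ, Set.mem_range] at h1 h2
        obtain ⟨v, rfl⟩ := h1
        obtain ⟨w, rfl⟩ := h2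
        have : v = w := hf h
        simp_all
    have := hM.card_le_nu
    rwa [Finset.card_image_of_injective _ (fun v w h => congrArg Prod.fst h),
      Finset.card_univ] at this

theorem partner_eq_some {U V : Type*} {M : Finset (V × U)} {v : V} {u : U}
    (h : partner M v = some u) : (v, u) ∈ M := by
  unfold partner at h
  split_ifs at h with h1
  cases h
  exact h1.choose_spec

theorem partner_isSome {U V : Type*} {M : Finset (V × U)} {v : V} (h : ∃ u, (v, u) ∈ M) :
    ∃ u, partner M v = some u := by
  unfold partner
  rw [dif_pos h]
  exact ⟨_, rfl⟩

end MatchingNumber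

/-! ### Exchange along alternating paths, and the number of candidates in `T`. -/

section Exchange

variable {U P : Type*}

/-- The nodes reached from those that `g` sends into `X` along the alternating paths of `f`
and `g`. -/
inductive AlternatingReach (f g : P → U) (X : Set U) : P → Prop
  | base {p : P} : g p ∈ X → AlternatingReach f g X p
  | step {p q : P} : AlternatingReach f g X p → f p = g q → AlternatingReach f g X q

/-- The theorem of Mendelsohn and Dulmage: if the matching `f` avoids `X`, there is a matching
that uses edges of `f` and `g` only, avoids `X`, and covers all that `g` covers outside `X`. -/
theorem exists_injective_avoiding_covering {f g : P → U} (hf : Function.Injective f)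
    (hg : Function.Injective g) {X : Set U} (hX : ∀ p, f p ∉ X) :
    ∃ h : P → U, Function.Injective h ∧ (∀ p, h p = f p ∨ h p = g p) ∧ (∀ p, h p ∉ X) ∧
      ∀ p, g p ∉ X → g p ∈ Set.range h := by
  classical
  -- Use `f` on the reached nodes and `g` elsewhere. A collision `f p = g q` with `p` reached would
  -- make `q` reached too.
  let C := AlternatingReach f g X
  refine ⟨fun p => if C p then f p else g p, ?_, ?_, ?_, ?_⟩
  · intro p q hpq
    by_cases hp : C p <;> by_cases hq : C q <;> simp only [hp, hq, if_true, if_false] at hpq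
    · exact hf hpq
    · exact absurd (AlternatingReach.step hp hpq) hq
    · exact absurd (AlternatingReach.step hq hpq.symm) hp
    · exact hg hpq
  · intro p
    by_cases hp : C p <;> simp [hp]
  · intro p
    by_cases hp : C p <;> simp only [hp, if_true, if_false]
    · exact hX p
    · exact fun h => hp (.base h)
  · intro p hp
    by_cases hC : C p
    · cases hC with
      | base h => exact absurd h hp
      | @step q _ hq h => exact ⟨q, (if_pos hq).trans h⟩
    · exact ⟨p, if_neg hC⟩

variable [Fintype U] [DecidableEq U] [Fintype P] [DecidableEq P] {H : P → Finset U}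

theorem mem_candidates_of_injective {us : List U} {h : P → U} (hi : Function.Injective h)
    (hH : ∀ p, h p ∈ H p) (hus : ∀ p, h p ∉ us) {u : U} (hu : u ∉ us)
    (hr : u ∉ Set.range h) : u ∈ candidates H us := by
  classical
  refine Finset.mem_filter.2 ⟨Finset.mem_univ _, hu, nu_eq_card_iff.2 ⟨h, hi, fun p => ?_⟩⟩
  have : h p ≠ u := fun h' => hr ⟨p, h'⟩
  simp [remove, hH, hus, this]

/-- The candidates that are not covered by a matching `g` of all predicted nodes are numerous. -/
theorem le_card_candidates_inter {us : List U} {g : P → U} (hg : Function.Injective g)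
    (hgH : ∀ p, g p ∈ H p) {T : Finset U} (hT : ∀ u, u ∉ T → u ∈ Set.range g)
    (hus : nu (remove H us) = Fintype.card P) {k : ℕ}
    (hk : us.length + k = Fintype.card U - Fintype.card P) :
    k ≤ (candidates H us ∩ T).card := by
  classical
  obtain ⟨f, hf, hfH⟩ := nu_eq_card_iff.1 hus
  have hfH' : ∀ p, f p ∈ H p ∧ f p ∉ us := fun p => by simpa [remove] using hfH p
  obtain ⟨h, hi, hfg, hX, hc⟩ := exists_injective_avoiding_covering hf hg
    (X := {u | u ∈ us}) (fun p => (hfH' p).2)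
  have hH : ∀ p, h p ∈ H p := fun p => by
    rcases hfg p with e | e <;> rw [e]
    exacts [(hfH' p).1, hgH p]
  -- The nodes outside `us` and the range of `h` number at least `|U| - |us| - |P| = k`. They lie in
  -- `T`, because `h` still covers everything outside `T` and `us`.
  have hsub : Finset.univ \ (us.toFinset ∪ Finset.univ.image h) ⊆ candidates H us ∩ T := by
    intro u hu
    simp only [Finset.mem_sdiff, Finset.mem_univ, Finset.mem_union, List.mem_toFinset,
      Finset.mem_image, true_and, not_or] at hu
    refine Finset.mem_inter.2 ⟨mem_candidates_of_injective hi hH hX hu.1 hu.2, ?_⟩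
    by_contra hn
    obtain ⟨p, rfl⟩ := hT u hn
    exact hu.2 (hc p hu.1)
  have h1 := Finset.card_le_card hsub
  have h2 := Finset.le_card_sdiff (us.toFinset ∪ Finset.univ.image h) Finset.univ
  have h3 := Finset.card_union_le us.toFinset (Finset.univ.image h)
  have h4 := List.toFinset_card_le us
  have h5 : (Finset.univ.image h).card ≤ Fintype.card P := Finset.card_image_le
  rw [Finset.card_univ] at h2
  omega

end Exchange

/-! ### Expectations with values in `ℝ≥0∞`. -/

section Expectation

variable {α β : Type*}

/-- The expectation of a nonnegative function of a random variable with distribution `p`. -/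
noncomputable def expect (p : PMF α) (g : α → ℝ≥0∞) : ℝ≥0∞ := ∑' a, p a * g a

theorem expect_bind (p : PMF α) (f : α → PMF β) (g : β → ℝ≥0∞) :
    expect (p.bind f) g = expect p fun a => expect (f a) g := by
  simp only [expect, PMF.bind_apply, ← ENNReal.tsum_mul_right, ← ENNReal.tsum_mul_left]
  rw [ENNReal.tsum_comm]
  simp only [mul_assoc]

theorem expect_pure (a : α) (g : α → ℝ≥0∞) : expect (PMF.pure a) g = g a := by
  classical
  rw [expect, tsum_eq_single a]
  · simp
  · intro b hb
    simp [PMF.pure_apply, hb]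

theorem expect_map (p : PMF α) (f : α → β) (g : β → ℝ≥0∞) :
    expect (p.map f) g = expect p fun a => g (f a) := by
  rw [PMF.map, expect_bind]
  simp [expect_pure]

theorem expect_mono {p : PMF α} {g h : α → ℝ≥0∞} (H : ∀ a ∈ p.support, g a ≤ h a) :
    expect p g ≤ expect p h := by
  refine ENNReal.tsum_le_tsum fun a => ?_
  by_cases ha : p a = 0
  · simp [ha]
  · gcongr
    exact H a ((PMF.mem_support_iff _ _).2 ha)

theorem expect_const (p : PMF α) (c : ℝ≥0∞) : expect p (fun _ => c) = c := by
  rw [expect, ENNReal.tsum_mul_right, p.tsum_coe, one_mul]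

theorem expect_add (p : PMF α) (g h : α → ℝ≥0∞) :
    expect p (fun a => g a + h a) = expect p g + expect p h := by
  simp only [expect, mul_add, ENNReal.tsum_add]

theorem expect_mul_const (p : PMF α) (g : α → ℝ≥0∞) (c : ℝ≥0∞) :
    expect p (fun a => g a * c) = expect p g * c := by
  simp only [expect, ← mul_assoc, ENNReal.tsum_mul_right]

theorem expect_uniformOfFinset (s : Finset α) (hs : s.Nonempty) (g : α → ℝ≥0∞) :
    expect (PMF.uniformOfFinset s hs) g = (∑ a ∈ s, g a) / s.card := by
  rw [expect, tsum_eq_sum (s := s), div_eq_mul_inv, mul_comm, Finset.mul_sum]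
  · exact Finset.sum_congr rfl fun a ha => by rw [PMF.uniformOfFinset_apply_of_mem _ ha]
  · intro a ha
    rw [PMF.uniformOfFinset_apply_of_notMem _ ha, zero_mul]

theorem expect_uniformOfFintype [Fintype α] [Nonempty α] (g : α → ℝ≥0∞) :
    expect (PMF.uniformOfFintype α) g = (∑ a, g a) / Fintype.card α := by
  rw [PMF.uniformOfFintype, expect_uniformOfFinset, Finset.card_univ]

end Expectation

/-! ### The random reserve. -/

section Reserve

variable {U P : Type*} [Fintype U] [DecidableEq U] [Fintype P] [DecidableEq P] {H : P → Finset U}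

theorem nodup_of_mem_support_reserve {k : ℕ} {us out : List U} (hus : us.Nodup)
    (h : out ∈ (reserve H k us).support) : out.Nodup := by
  induction k generalizing us with
  | zero =>
    rw [reserve, PMF.support_pure, Set.mem_singleton_iff] at h
    exact h ▸ hus
  | succ k ih =>
    rw [reserve] at h
    split_ifs at h with hc
    · obtain ⟨u, hu, h⟩ := (PMF.mem_support_bind_iff _ _ _).1 h
      rw [PMF.support_uniformOfFinset, Finset.mem_coe] at hu
      have hu' := (Finset.mem_filter.1 hu).2.1
      refine ih ?_ h
      rw [List.nodup_append]
      refine ⟨hus, List.nodup_singleton u, ?_⟩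
      rintro a ha b hb rfl
      rw [List.mem_singleton] at hb
      exact hu' (hb ▸ ha)
    · rw [PMF.support_pure, Set.mem_singleton_iff] at h
      exact h ▸ hus

variable {g : P → U} {T : Finset U}

/-- Some candidate exists as long as draws remain, so the drawing never stops early. -/
theorem of_mem_support_reserve (hg : Function.Injective g)
    (hgH : ∀ p, g p ∈ H p) (hT : ∀ u, u ∉ T → u ∈ Set.range g) {k : ℕ} {us out : List U}
    (hus : nu (remove H us) = Fintype.card P)
    (hk : us.length + k = Fintype.card U - Fintype.card P)
    (h : out ∈ (reserve H k us).support) :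
    out.length = Fintype.card U - Fintype.card P ∧ nu (remove H out) = Fintype.card P := by
  induction k generalizing us with
  | zero =>
    rw [reserve, PMF.support_pure, Set.mem_singleton_iff] at h
    subst h
    exact ⟨hk, hus⟩
  | succ k ih =>
    have hc : (candidates H us).Nonempty := by
      have := le_card_candidates_inter hg hgH hT hus hk
      exact (Finset.card_pos.1 (by omega : 0 < (candidates H us ∩ T).card)).mono
        Finset.inter_subset_left
    rw [reserve, dif_pos hc] at h
    obtain ⟨u, hu, h⟩ := (PMF.mem_support_bind_iff _ _ _).1 h
    rw [PMF.support_uniformOfFinset, Finset.mem_coe] at hu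
    refine ih (Finset.mem_filter.1 hu).2.2 ?_ h
    simp
    omega

/-- With `j` draws left, the next node falls in `T` with probability at least `j / |U|`, whatever
was drawn before; these bounds add up. -/
theorem le_expect_countP_reserve (hg : Function.Injective g)
    (hgH : ∀ p, g p ∈ H p) (hT : ∀ u, u ∉ T → u ∈ Set.range g) {k : ℕ} {us : List U}
    (hus : nu (remove H us) = Fintype.card P)
    (hk : us.length + k = Fintype.card U - Fintype.card P) :
    (us.countP (· ∈ T) : ℝ≥0∞) + ((∑ j ∈ Finset.range (k + 1), j : ℕ) : ℝ≥0∞) / Fintype.card U ≤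
      expect (reserve H k us) fun out => (out.countP (· ∈ T) : ℝ≥0∞) := by
  induction k generalizing us with
  | zero => simp [reserve, expect_pure]
  | succ k ih =>
    have hle := le_card_candidates_inter hg hgH hT hus hk
    have hc : (candidates H us).Nonempty :=
      (Finset.card_pos.1 (by omega : 0 < (candidates H us ∩ T).card)).mono
        Finset.inter_subset_left
    rw [reserve, dif_pos hc, expect_bind]
    have h1 : ∀ u ∈ (PMF.uniformOfFinset (candidates H us) hc).support,
        ((us.countP (· ∈ T) : ℝ≥0∞) +
          ((∑ j ∈ Finset.range (k + 1), j : ℕ) : ℝ≥0∞) / Fintype.card U) +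
          (if u ∈ T then 1 else 0) ≤
        expect (reserve H k (us ++ [u])) fun out => (out.countP (· ∈ T) : ℝ≥0∞) := by
      intro u hu
      rw [PMF.support_uniformOfFinset, Finset.mem_coe] at hu
      refine le_trans (le_of_eq ?_) (ih (us := us ++ [u]) (Finset.mem_filter.1 hu).2.2 ?_)
      · rw [List.countP_append]
        by_cases hu : u ∈ T <;> simp [hu]
        ring
      · simp
        omega
    refine le_trans ?_ (expect_mono h1)
    rw [expect_add, expect_const, expect_uniformOfFinset, ← Finset.sum_filter,
      Finset.filter_mem_eq_inter, Finset.sum_const, nsmul_eq_mul, mul_one,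
      Finset.sum_range_succ _ (k + 1), Nat.cast_add, ENNReal.add_div, ← add_assoc]
    gcongr
    exact Finset.card_le_univ _

end Reserve

/-! ### RANKING for a fixed order of preference. -/

section Ranking

variable {U : Type*} [DecidableEq U]

/-- One step of RANKING: the list of the available offline nodes, in the order of preference, loses
the first one that belongs to the neighbourhood `N`. -/
def rankingStep (L : List U) (N : Finset U) : List U :=
  match L.find? (fun u => decide (u ∈ N)) with
  | some u => L.erase u
  | none => L

/-- The offline nodes that RANKING leaves available after the arrivals `Ns`. -/
def available (L : List U) (Ns : List (Finset U)) : List U := Ns.foldl rankingStep L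

theorem rankingStep_of_eq_some {L : List U} {N : Finset U} {u : U}
    (h : L.find? (fun u => decide (u ∈ N)) = some u) : rankingStep L N = L.erase u := by
  simp [rankingStep, h]

theorem rankingStep_of_eq_none {L : List U} {N : Finset U}
    (h : L.find? (fun u => decide (u ∈ N)) = none) : rankingStep L N = L := by
  simp [rankingStep, h]

theorem rankingStep_sublist (L : List U) (N : Finset U) : (rankingStep L N).Sublist L := by
  rcases h : L.find? (fun u => decide (u ∈ N)) with _ | u
  · rw [rankingStep_of_eq_none h]
  · rw [rankingStep_of_eq_some h]
    exact List.erase_sublist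

theorem available_cons (L : List U) (N : Finset U) (Ns : List (Finset U)) :
    available L (N :: Ns) = available (rankingStep L N) Ns := rfl

theorem available_append (L : List U) (Ns Ns' : List (Finset U)) :
    available L (Ns ++ Ns') = available (available L Ns) Ns' :=
  List.foldl_append

theorem available_sublist (L : List U) (Ns : List (Finset U)) : (available L Ns).Sublist L := by
  induction Ns generalizing L with
  | nil => exact List.Sublist.refl L
  | cons N Ns ih => exact (ih _).trans (rankingStep_sublist L N)

theorem find?_erase_of_ne {L : List U} {p : U → Bool} {w x : U} (h : L.find? p = some w)
    (hx : w ≠ x) : (L.erase x).find? p = some w := by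
  induction L with
  | nil => simp at h
  | cons a L ih =>
    rw [List.erase_cons]
    split_ifs with hax
    · have hax : a = x := by simpa using hax
      subst hax
      rw [List.find?_cons] at h
      split at h
      · exact absurd (Option.some.inj h).symm hx
      · exact h
    · rw [List.find?_cons] at h ⊢
      split at h
      · exact h
      · exact ih h

/-- Removing one offline node changes the set of available nodes by one node at most. -/
theorem exists_available_erase (L : List U) (x : U) (Ns : List (Finset U)) :
    ∃ y, available (L.erase x) Ns = (available L Ns).erase y := by
  induction Ns generalizing L x with
  | nil => exact ⟨x, rfl⟩
  | cons N Ns ih =>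
    simp only [available_cons]
    rcases h : L.find? (fun u => decide (u ∈ N)) with _ | w
    · have h' : (L.erase x).find? (fun u => decide (u ∈ N)) = none :=
        List.find?_eq_none.2 fun u hu => List.find?_eq_none.1 h u (List.mem_of_mem_erase hu)
      rw [rankingStep_of_eq_none h, rankingStep_of_eq_none h']
      exact ih L x
    · rw [rankingStep_of_eq_some h]
      by_cases hx : w = x
      · subst hx
        rcases h' : (L.erase w).find? (fun u => decide (u ∈ N)) with _ | z
        · rw [rankingStep_of_eq_none h']
          -- `L` may have repetitions; a second copy of `w` would have been found. Otherwise erasing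
          -- `w` at the end changes nothing.
          by_cases hw : w ∈ L.erase w
          · have := List.find?_eq_none.1 h' w hw
            exact absurd (List.find?_some h) this
          · refine ⟨w, (List.erase_of_not_mem fun hw' => hw ?_).symm⟩
            exact (available_sublist _ _).subset hw'
        · rw [rankingStep_of_eq_some h']
          -- The arrival takes `z` in place of `w`, so from now on `z` is the node missing.
          exact ih _ z
      · rw [rankingStep_of_eq_some (find?_erase_of_ne h hx), List.erase_comm]
        exact ih _ x

/-- Removing an offline node that is not used does not change the other decisions. -/
theorem available_erase_of_mem {L : List U} (hL : L.Nodup) {u : U} {Ns : List (Finset U)}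
    (hu : u ∈ available L Ns) : available (L.erase u) Ns = (available L Ns).erase u := by
  induction Ns generalizing L with
  | nil => rfl
  | cons N Ns ih =>
    simp only [available_cons] at hu ⊢
    have hs := hL.sublist (rankingStep_sublist L N)
    rw [← ih hs hu]
    rcases h : L.find? (fun u => decide (u ∈ N)) with _ | w
    · have h' : (L.erase u).find? (fun u => decide (u ∈ N)) = none :=
        List.find?_eq_none.2 fun v hv => List.find?_eq_none.1 h v (List.mem_of_mem_erase hv)
      rw [rankingStep_of_eq_none h, rankingStep_of_eq_none h']
    · have hwu : w ≠ u := by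
        rintro rfl
        rw [rankingStep_of_eq_some h] at hu
        exact hL.not_mem_erase ((available_sublist _ _).subset hu)
      rw [rankingStep_of_eq_some h, rankingStep_of_eq_some (find?_erase_of_ne h hwu),
        List.erase_comm]

/-- `B` inherits the order of `R`, so the first hit `w'` in `B` stands no later in `R` than any
other hit `w`. -/
theorem mem_take_of_find?_eq_some {B R : List U} (hBR : B.Sublist R) (hR : R.Nodup)
    {p : U → Bool} {w w' : U} (h : B.find? p = some w') (hw : w ∈ B) (hp : p w) {k : ℕ}
    (hk : w ∈ R.take k) : w' ∈ R.take k := by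
  obtain ⟨-, as, bs, rfl, has⟩ := List.find?_eq_some_iff_append.1 h
  have hw2 : w = w' ∨ w ∈ bs := by
    rcases List.mem_append.1 hw with h1 | h1
    · have := has w h1
      simp [hp] at this
    · exact List.mem_cons.1 h1
  rcases hw2 with rfl | hw2
  · exact hk
  have h2 : List.Sublist [w', w] R :=
    (((List.singleton_sublist.2 hw2).cons_cons w').trans
      (List.sublist_append_right as (w' :: bs))).trans hBR
  rw [← List.take_append_drop k R] at h2 hR
  obtain ⟨l₁, l₂, h3, h4, h5⟩ := List.sublist_append_iff.1 h2
  cases l₁ with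
  | nil =>
    have h6 : w ∈ R.drop k := h5.subset (by rw [List.nil_append] at h3; rw [← h3]; simp)
    exact absurd h6 (List.disjoint_of_nodup_append hR hk)
  | cons a l₁ =>
    have : w' = a := by simpa using (List.cons.inj h3).1
    exact this ▸ h4.subset List.mem_cons_self

/-- The list `R`, with its entry `u` moved to position `t`. -/
def moveTo (u : U) (t : ℕ) (R : List U) : List U :=
  (R.erase u).take t ++ u :: (R.erase u).drop t

theorem moveTo_perm {u : U} (t : ℕ) {R : List U} (hu : u ∈ R) : (moveTo u t R).Perm R := by
  refine (List.perm_middle.trans ?_).trans (List.perm_cons_erase hu).symm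
  rw [List.take_append_drop]

theorem erase_moveTo {u : U} {t : ℕ} {R : List U} (hR : R.Nodup) :
    (moveTo u t R).erase u = R.erase u := by
  have : u ∉ (R.erase u).take t := fun h => hR.not_mem_erase (List.mem_of_mem_take h)
  rw [moveTo, List.erase_append_right _ this, List.erase_cons_head, List.take_append_drop]

theorem moveTo_idxOf {u : U} {R : List U} (hu : u ∈ R) : moveTo u (R.idxOf u) R = R := by
  obtain ⟨as, bs, rfl, h⟩ := List.eq_append_cons_of_mem hu
  have h1 : (as ++ u :: bs).erase u = as ++ bs := by
    rw [List.erase_append_right _ h, List.erase_cons_head]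
  have h2 : (as ++ u :: bs).idxOf u = as.length := by
    rw [List.idxOf_append_of_notMem h, List.idxOf_cons_self, add_zero]
  rw [moveTo, h1, h2, List.take_left, List.drop_left]

theorem getElem?_moveTo {u : U} {t : ℕ} {R : List U} (hu : u ∈ R) (ht : t < R.length) :
    (moveTo u t R)[t]? = some u := by
  have h1 : (R.erase u).length = R.length - 1 := List.length_erase_of_mem hu
  have h2 : ((R.erase u).take t).length = t := by rw [List.length_take]; omega
  rw [moveTo, List.getElem?_append_right h2.le, h2]
  simp

theorem take_erase_subset (u : U) (t : ℕ) (R : List U) :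
    (R.erase u).take t ⊆ R.take (t + 1) := by
  induction R generalizing t with
  | nil => simp
  | cons a R ih =>
    rw [List.erase_cons]
    split_ifs with h
    · exact List.subset_cons_of_subset _ fun _ h => h
    · cases t with
      | zero => simp
      | succ t =>
        rw [List.take_succ_cons, List.take_succ_cons]
        exact List.cons_subset_cons _ (ih t)

/-- The main lemma on RANKING: if the node `u` would remain unmatched at position `t`, then its
neighbour is matched to one of the first offline nodes wherever `u` is. -/
theorem exists_find?_of_mem_available_moveTo {R : List U} (hR : R.Nodup) {u : U} (hu : u ∈ R)
    {t : ℕ} (ht : t < R.length) {pre post : List (Finset U)} {N : Finset U} (hN : u ∈ N)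
    (h : u ∈ available (moveTo u t R) (pre ++ N :: post)) :
    ∃ w ∈ R.take (t + 1), (available R pre).find? (fun v => decide (v ∈ N)) = some w := by
  set Φ := moveTo u t R with hΦ
  have hΦn : Φ.Nodup := (moveTo_perm t hu).nodup_iff.2 hR
  rw [available_append, available_cons] at h
  set B := available Φ pre with hB
  have hBs : B.Sublist Φ := available_sublist _ _
  have huB : u ∈ B := ((available_sublist _ _).trans (rankingStep_sublist _ _)).subset h
  rcases hf : B.find? (fun v => decide (v ∈ N)) with _ | w
  · have := List.find?_eq_none.1 hf u huB
    simp [hN] at this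
  have hwu : w ≠ u := by
    rintro rfl
    rw [rankingStep_of_eq_some hf] at h
    exact (hΦn.sublist hBs).not_mem_erase ((available_sublist _ _).subset h)
  have h1 : (R.erase u).length = R.length - 1 := List.length_erase_of_mem hu
  have h2 : ((R.erase u).take t).length = t := by rw [List.length_take]; omega
  have h3 : Φ.take (t + 1) = (R.erase u).take t ++ [u] := by
    rw [hΦ, moveTo, List.take_append, h2, List.take_of_length_le (by omega)]
    simp
  -- As `u` is available but unused, `N` prefers some `w` that precedes `u` in `Φ`.
  have hw : w ∈ Φ.take (t + 1) :=
    mem_take_of_find?_eq_some hBs hΦn hf huB (by simpa using hN) (by rw [h3]; simp)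
  have hw' : w ∈ R.take (t + 1) := by
    rw [h3, List.mem_append, List.mem_singleton] at hw
    exact take_erase_subset u t R (hw.resolve_right hwu)
  have h4 := find?_erase_of_ne hf hwu
  -- Deleting the unused `u` keeps the choice `w`. Putting `u` back at its place in `R` can only
  -- enlarge the set of available nodes, so `w` stays available and `N` chooses `w` or something
  -- earlier.
  rw [hB, ← available_erase_of_mem hΦn huB, hΦ, erase_moveTo hR] at h4
  obtain ⟨x, hx⟩ := exists_available_erase R u pre
  rw [hx] at h4
  have hwA : w ∈ available R pre := List.mem_of_mem_erase (List.mem_of_find?_eq_some h4)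
  have hwN : w ∈ N := by simpa using List.find?_some h4
  rcases h5 : (available R pre).find? (fun v => decide (v ∈ N)) with _ | w'
  · have := List.find?_eq_none.1 h5 w hwA
    simp [hwN] at this
  · exact ⟨w', mem_take_of_find?_eq_some (available_sublist _ _) hR h5 hwA
      (by simpa using hwN) hw', rfl⟩

theorem notMem_available_of_find?_eq_some {R : List U} (hR : R.Nodup)
    {pre post : List (Finset U)} {N : Finset U} {w : U}
    (h : (available R pre).find? (fun v => decide (v ∈ N)) = some w) :
    w ∉ available R (pre ++ N :: post) := by
  rw [available_append, available_cons, rankingStep_of_eq_some h]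
  exact fun h' => (hR.sublist (available_sublist _ _)).not_mem_erase
    ((available_sublist _ _).subset h')

/-- RANKING matches different arrivals to different offline nodes. -/
theorem eq_of_find?_take_eq {R : List U} (hR : R.Nodup) {Ns : List (Finset U)} {i j : ℕ}
    (hi : i < Ns.length) (hj : j < Ns.length) {w : U}
    (h : (available R (Ns.take i)).find? (fun v => decide (v ∈ Ns[i])) = some w)
    (h' : (available R (Ns.take j)).find? (fun v => decide (v ∈ Ns[j])) = some w) : i = j := by
  wlog hij : i < j generalizing i j
  · rcases Nat.lt_or_ge j i with h1 | h1
    · exact (this hj hi h' h h1).symm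
    · omega
  exfalso
  have h1 : Ns.take j = Ns.take i ++ Ns[i] :: (Ns.take j).drop (i + 1) := by
    have h2 : i < (Ns.take j).length := by simp; omega
    have h3 := List.take_append_drop i (Ns.take j)
    rw [List.drop_eq_getElem_cons h2, List.take_take, min_eq_left hij.le] at h3
    rw [List.getElem_take] at h3
    exact h3.symm
  have h2 := List.mem_of_find?_eq_some h'
  rw [h1] at h2
  exact notMem_available_of_find?_eq_some hR h h2

end Ranking

/-! ### Averaging RANKING over all orders. -/

section RankingCount

variable {U : Type*} [DecidableEq U]

/-- The number of matched offline nodes among the first `t` ones. -/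
def matchedBefore (Ns : List (Finset U)) (t : ℕ) (R : List U) : ℕ :=
  ((R.take t).toFinset.filter (· ∉ available R Ns)).card

/-- The arrival with number `i` is matched to one of the first `t` offline nodes. -/
def MatchedBefore (Ns : List (Finset U)) (t : ℕ) (R : List U) (i : ℕ) : Prop :=
  ∃ w ∈ R.take t, ∃ h : i < Ns.length,
    (available R (Ns.take i)).find? (fun v => decide (v ∈ Ns[i])) = some w

-- Distinct nodes of `S` have distinct arrivals, and RANKING gives these distinct partners.
open Classical in
theorem card_filter_matchedBefore_le {Ns : List (Finset U)} {t : ℕ} {R : List U} (hR : R.Nodup)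
    {S : Finset U} {a : U → ℕ} (ha : Set.InjOn a S) :
    (S.filter fun u => MatchedBefore Ns t R (a u)).card ≤ matchedBefore Ns t R := by
  have h : ∀ u ∈ S.filter fun u => MatchedBefore Ns t R (a u),
      MatchedBefore Ns t R (a u) := fun u hu => (Finset.mem_filter.1 hu).2
  choose! f hf hlen hfind using h
  refine Finset.card_le_card_of_injOn f (fun u hu => ?_) fun u hu v hv huv => ?_
  · refine Finset.mem_coe.2 (Finset.mem_filter.2 ⟨List.mem_toFinset.2 (hf u hu), ?_⟩)
    have := notMem_available_of_find?_eq_some (post := Ns.drop (a u + 1)) hR (hfind u hu)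
    rwa [← List.drop_eq_getElem_cons, List.take_append_drop] at this
  · refine ha (Finset.mem_filter.1 hu).1 (Finset.mem_filter.1 hv).1 ?_
    refine eq_of_find?_take_eq hR (hlen u hu) (hlen v hv) (hfind u hu) ?_
    rw [huv]
    exact hfind v hv

open Classical in
theorem matchedBefore_succ {Ns : List (Finset U)} {t : ℕ} {R : List U} (hR : R.Nodup)
    (ht : t < R.length) :
    matchedBefore Ns (t + 1) R = matchedBefore Ns t R + if R[t] ∉ available R Ns then 1 else 0 := by
  have h1 : R.take (t + 1) = R.take t ++ [R[t]] := by simp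
  have h2 : R[t] ∉ (R.take t).toFinset := by
    rw [List.mem_toFinset]
    intro h
    have h3 := hR.sublist (List.take_sublist (t + 1) R)
    rw [h1] at h3
    exact List.disjoint_of_nodup_append h3 h (by simp)
  have h4 : (R.take (t + 1)).toFinset = insert R[t] (R.take t).toFinset := by
    ext
    simp only [h1, List.mem_toFinset, List.mem_append, List.mem_singleton, Finset.mem_insert]
    exact or_comm
  rw [matchedBefore, h4, Finset.filter_insert]
  split_ifs with h5
  · rfl
  · rw [Finset.card_insert_of_notMem (fun h => h2 (Finset.mem_filter.1 h).1)]
    rfl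

/-- The orderings of the list `us`. -/
def orderings (us : List U) : Finset (List U) := us.permutations.toFinset

theorem mem_orderings {us R : List U} : R ∈ orderings us ↔ R.Perm us := by
  rw [orderings, List.mem_toFinset, List.mem_permutations]

theorem card_orderings {us : List U} (h : us.Nodup) :
    (orderings us).card = us.length.factorial := by
  rw [orderings, List.toFinset_card_of_nodup (List.nodup_permutations us h),
    List.length_permutations]

-- An ordering is recovered from its image under `moveTo u t` and the original position of `u`, so
-- each image arises at most `us.length` times.
open Classical in
theorem card_orderings_moveTo_le {us : List U} {u : U} (hus : us.Nodup) (hu : u ∈ us)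
    (t : ℕ) (Ns : List (Finset U)) (ht : t < us.length) :
    ((orderings us).filter fun R => u ∉ available (moveTo u t R) Ns).card ≤
      us.length *
        ((orderings us).filter fun R => R[t]? = some u ∧ u ∉ available R Ns).card := by
  nth_rewrite 1 [← Finset.card_range us.length]
  rw [← Finset.card_product]
  refine Finset.card_le_card_of_injOn (fun R => (R.idxOf u, moveTo u t R)) (fun R hR => ?_)
    fun R hR R' hR' h => ?_
  · obtain ⟨hR, h⟩ := Finset.mem_filter.1 hR
    rw [mem_orderings] at hR
    have huR := hR.mem_iff.2 hu
    refine Finset.mem_coe.2 (Finset.mem_product.2 ⟨?_, Finset.mem_filter.2 ⟨?_, ?_, h⟩⟩)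
    · rw [Finset.mem_range, ← hR.length_eq]
      exact List.idxOf_lt_length_iff.2 huR
    · exact mem_orderings.2 ((moveTo_perm t huR).trans hR)
    · exact getElem?_moveTo huR (hR.length_eq ▸ ht)
  · have h1 := mem_orderings.1 (Finset.mem_filter.1 hR).1
    have h2 := mem_orderings.1 (Finset.mem_filter.1 hR').1
    obtain ⟨h3, h4⟩ := Prod.mk.inj h
    have h5 : R.erase u = R'.erase u := by
      rw [← erase_moveTo (h1.nodup_iff.2 hus) (t := t), h4, erase_moveTo (h2.nodup_iff.2 hus)]
    rw [← moveTo_idxOf (h1.mem_iff.2 hu), ← moveTo_idxOf (h2.mem_iff.2 hu), moveTo, moveTo, h3, h5]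

/-- For each ordering and each `u ∈ S`, either `u` is matched once moved to position `t`, or its
arrival `a u` is matched among the first `t + 1` nodes of the original ordering. Summed over all
orderings and `u`, the first case costs at most `d` times the growth of the sum from `t` to `t + 1`,
the second at most the sum at `t + 1`. -/
theorem sum_matchedBefore_recursion {us : List U} (hus : us.Nodup) {Ns : List (Finset U)}
    {S : Finset U} (hS : ∀ u ∈ S, u ∈ us) {a : U → ℕ} (ha : Set.InjOn a S)
    (haN : ∀ u ∈ S, ∃ h : a u < Ns.length, u ∈ Ns[a u]) {t : ℕ} (ht : t < us.length) :
    S.card * us.length.factorial + us.length * ∑ R ∈ orderings us, matchedBefore Ns t R ≤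
      (us.length + 1) * ∑ R ∈ orderings us, matchedBefore Ns (t + 1) R := by
  classical
  have h1 : ∀ u ∈ S, us.length.factorial ≤
      us.length * ((orderings us).filter fun R => R[t]? = some u ∧ u ∉ available R Ns).card +
        ((orderings us).filter fun R => MatchedBefore Ns (t + 1) R (a u)).card := by
    intro u hu
    refine le_trans ?_ (Nat.add_le_add_right (card_orderings_moveTo_le hus (hS u hu) t Ns ht) _)
    rw [← card_orderings hus, ← Finset.filter_union_filter_not_eq
      (fun R => u ∉ available (moveTo u t R) Ns) (orderings us)]
    refine (Finset.card_union_le _ _).trans ?_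
    rw [Finset.filter_union_filter_not_eq]
    gcongr with R hR
    intro h
    rw [not_not] at h
    have hR' := mem_orderings.1 hR
    obtain ⟨h2, h3⟩ := haN u hu
    have h4 : Ns = Ns.take (a u) ++ Ns[a u] :: Ns.drop (a u + 1) := by
      rw [← List.drop_eq_getElem_cons, List.take_append_drop]
    rw [h4] at h
    obtain ⟨w, hw, h5⟩ := exists_find?_of_mem_available_moveTo (hR'.nodup_iff.2 hus)
      (hR'.mem_iff.2 (hS u hu)) (hR'.length_eq ▸ ht) h3 h
    exact ⟨w, hw, h2, h5⟩
  have h2 : ∑ u ∈ S, ((orderings us).filter fun R => MatchedBefore Ns (t + 1) R (a u)).card ≤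
      ∑ R ∈ orderings us, matchedBefore Ns (t + 1) R := by
    simp only [Finset.card_filter]
    rw [Finset.sum_comm]
    refine Finset.sum_le_sum fun R hR => ?_
    rw [← Finset.card_filter]
    exact card_filter_matchedBefore_le ((mem_orderings.1 hR).nodup_iff.2 hus) ha
  have h3 : (∑ R ∈ orderings us, matchedBefore Ns t R) + ∑ u ∈ S,
      ((orderings us).filter fun R => R[t]? = some u ∧ u ∉ available R Ns).card ≤
        ∑ R ∈ orderings us, matchedBefore Ns (t + 1) R := by
    simp only [Finset.card_filter]
    rw [Finset.sum_comm, ← Finset.sum_add_distrib]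
    refine Finset.sum_le_sum fun R hR => ?_
    have hR' := mem_orderings.1 hR
    have htR : t < R.length := hR'.length_eq ▸ ht
    rw [matchedBefore_succ (hR'.nodup_iff.2 hus) htR, ← Finset.card_filter]
    gcongr
    split_ifs with h4
    · rw [Nat.le_zero, Finset.card_eq_zero, Finset.filter_eq_empty_iff]
      rintro u - ⟨h5, h6⟩
      rw [List.getElem?_eq_getElem htR] at h5
      exact h6 (Option.some.inj h5 ▸ h4)
    · refine Finset.card_le_one.2 fun u hu v hv => ?_
      have hu' := (Finset.mem_filter.1 hu).2.1
      have hv' := (Finset.mem_filter.1 hv).2.1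
      exact Option.some.inj (hu'.symm.trans hv')
  have h4 := Finset.sum_le_sum h1
  rw [Finset.sum_const, smul_eq_mul, Finset.sum_add_distrib, ← Finset.mul_sum] at h4
  have h5 := Nat.mul_le_mul_left us.length h3
  rw [mul_add] at h5
  rw [add_mul, one_mul]
  omega

/-- `C` is the fixed point of the recursion; each step multiplies the bound on the gap `C - K t` by
`d / (d + 1)`. -/
theorem le_of_recursion {d : ℕ} {C : ℝ} {K : ℕ → ℝ} (h0 : K 0 = 0)
    (h : ∀ t < d, C + d * K t ≤ (d + 1) * K (t + 1)) :
    ∀ t ≤ d, C * (1 - ((d : ℝ) / (d + 1)) ^ t) ≤ K t := by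
  intro t
  induction t with
  | zero => simp [h0]
  | succ t ih =>
    intro ht
    have h1 := ih (by omega)
    have h2 := h t (by omega)
    have hd : (0 : ℝ) < d + 1 := by positivity
    have h3 : (d : ℝ) * (C * (1 - ((d : ℝ) / (d + 1)) ^ t)) ≤ d * K t := by gcongr
    refine le_of_mul_le_mul_left ((le_trans (le_of_eq ?_) (add_le_add_right h3 C)).trans h2) hd
    rw [pow_succ]
    field_simp
    ring

theorem matchedBefore_length {Ns : List (Finset U)} {R : List U} (hR : R.Nodup) :
    matchedBefore Ns R.length R = R.length - (available R Ns).length := by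
  have hs := available_sublist R Ns
  have h1 : R.toFinset.filter (· ∉ available R Ns) = R.toFinset \ (available R Ns).toFinset := by
    ext
    simp
  rw [matchedBefore, List.take_length, h1, Finset.card_sdiff_of_subset,
    List.toFinset_card_of_nodup hR, List.toFinset_card_of_nodup (hR.sublist hs)]
  intro u hu
  rw [List.mem_toFinset] at hu ⊢
  exact hs.subset hu

theorem expect_randomOrder {us : List U} (hus : us.Nodup) (g : List U → ℝ≥0∞) :
    expect (randomOrder us) g = (∑ R ∈ orderings us, g R) / (us.length.factorial : ℕ) := by
  have hinj : Function.Injective fun π : Equiv.Perm (Fin us.length) =>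
      List.ofFn fun i => us.get (π i) := by
    intro π σ h
    ext i : 1
    exact List.nodup_iff_injective_get.1 hus (congrFun (List.ofFn_injective h) i)
  have h1 : Finset.univ.image (fun π : Equiv.Perm (Fin us.length) =>
      List.ofFn fun i => us.get (π i)) = orderings us := by
    refine Finset.eq_of_subset_of_card_le ?_ ?_
    · intro R hR
      obtain ⟨π, -, rfl⟩ := Finset.mem_image.1 hR
      rw [mem_orderings]
      have := Equiv.Perm.ofFn_comp_perm π us.get
      rwa [List.ofFn_get] at this
    · rw [Finset.card_image_of_injective _ hinj, card_orderings hus, Finset.card_univ,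
        Fintype.card_perm, Fintype.card_fin]
  rw [randomOrder, expect_map, expect_uniformOfFintype, ← h1,
    Finset.sum_image fun π _ σ _ h => hinj h, Fintype.card_perm, Fintype.card_fin]

/-- RANKING with `d` offline nodes in random order, on a graph with a matching of size `c`, finds
in expectation a matching of size at least `c * (1 - (d / (d + 1)) ^ d)`. -/
theorem le_expect_ranking {us : List U} (hus : us.Nodup) {Ns : List (Finset U)}
    {S : Finset U} (hS : ∀ u ∈ S, u ∈ us) {a : U → ℕ} (ha : Set.InjOn a S)
    (haN : ∀ u ∈ S, ∃ h : a u < Ns.length, u ∈ Ns[a u]) :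
    (S.card : ℝ≥0∞) * ENNReal.ofReal (1 - ((us.length : ℝ) / (us.length + 1)) ^ us.length) ≤
      expect (randomOrder us) fun R => ((us.length - (available R Ns).length : ℕ) : ℝ≥0∞) := by
  set d := us.length with hd
  have h1 := le_of_recursion (d := d) (C := S.card * d.factorial)
    (K := fun t => ((∑ R ∈ orderings us, matchedBefore Ns t R : ℕ) : ℝ))
    (by simp [matchedBefore])
    (fun t ht => by exact_mod_cast sum_matchedBefore_recursion hus hS ha haN ht) d le_rfl
  have h2 : ∑ R ∈ orderings us, matchedBefore Ns d R =
      ∑ R ∈ orderings us, (d - (available R Ns).length) := by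
    refine Finset.sum_congr rfl fun R hR => ?_
    have hR' := mem_orderings.1 hR
    rw [hd, ← hR'.length_eq, matchedBefore_length (hR'.nodup_iff.2 hus)]
  rw [expect_randomOrder hus, ENNReal.le_div_iff_mul_le (Or.inl (by positivity))
    (Or.inl (ENNReal.natCast_ne_top _)), ← Nat.cast_sum, ← h2]
  rw [← ENNReal.ofReal_natCast, ← ENNReal.ofReal_natCast, ← ENNReal.ofReal_natCast (∑ R ∈ _, _),
    ← ENNReal.ofReal_mul (by positivity), ← ENNReal.ofReal_mul' (by positivity)]
  refine ENNReal.ofReal_le_ofReal (le_trans (le_of_eq ?_) h1)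
  ring

end RankingCount

/-! ### The online phase: legality and the number of matched nodes. -/

section OnlinePhase

variable {U P : Type*} [Fintype U] [DecidableEq U] [Fintype P] [DecidableEq P]

open Classical in
/-- The arrivals that are treated as adversarial, if the predicted nodes in `s` have not been seen
before. -/
noncomputable def adversarialArrivals (H : P → Finset U) :
    Finset P → List (Finset U) → List (Finset U)
  | _, [] => []
  | s, N :: Ns =>
      if h : ∃ p, p ∈ s ∧ H p = N then adversarialArrivals H (s.erase h.choose) Ns
      else N :: adversarialArrivals H s Ns

/-- The decisions of the online phase, from a given state. -/
noncomputable def decisions (H : P → Finset U) (M : Finset (P × U)) :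
    Finset P × List U → List (Finset U) → List (Option U)
  | _, [] => []
  | s, N :: Ns => (onlineStep H M s N).1 :: decisions H M (onlineStep H M s N).2 Ns

variable {H : P → Finset U} {M : Finset (P × U)}

theorem run_onlinePhase (R : List U) (Ns : List (Finset U)) :
    run (onlinePhase H M R) Ns = decisions H M (Finset.univ, R) Ns := by
  have h : ∀ past, runFrom (onlinePhase H M R) past Ns = decisions H M
      (past.foldl (fun s N' => (onlineStep H M s N').2) (Finset.univ, R)) Ns := by
    induction Ns with
    | nil => exact fun _ => rfl
    | cons N Ns ih =>
      intro past
      rw [runFrom, decisions, ih, List.foldl_append]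
      rfl
  exact h []

theorem onlineStep_of_exists {s : Finset P × List U} {N : Finset U}
    (h : ∃ p, p ∈ s.1 ∧ H p = N) :
    ∃ p, p ∈ s.1 ∧ H p = N ∧ onlineStep H M s N = (partner M p, (s.1.erase p, s.2)) ∧
      ∀ Ns, adversarialArrivals H s.1 (N :: Ns) = adversarialArrivals H (s.1.erase p) Ns := by
  refine ⟨h.choose, h.choose_spec.1, h.choose_spec.2, ?_, fun Ns => ?_⟩
  · rw [onlineStep, dif_pos h]
  · rw [adversarialArrivals, dif_pos h]

theorem onlineStep_of_not_exists {s : Finset P × List U} {N : Finset U}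
    (h : ¬∃ p, p ∈ s.1 ∧ H p = N) :
    onlineStep H M s N =
      (s.2.find? (fun u => decide (u ∈ N)), (s.1, rankingStep s.2 N)) := by
  rw [onlineStep, dif_neg h]
  rcases hf : s.2.find? (fun u => decide (u ∈ N)) with _ | u
  · rw [rankingStep_of_eq_none hf]
  · rw [rankingStep_of_eq_some hf]

theorem adversarialArrivals_of_not_exists {s : Finset P} {N : Finset U}
    (h : ¬∃ p, p ∈ s ∧ H p = N) (Ns : List (Finset U)) :
    adversarialArrivals H s (N :: Ns) = N :: adversarialArrivals H s Ns := by
  rw [adversarialArrivals, dif_neg h]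

/-- The number of online nodes matched by the online phase. -/
theorem length_reduceOption_decisions (hM : ∀ p, ∃ u, (p, u) ∈ M) (s : Finset P × List U)
    (Ns : List (Finset U)) :
    (decisions H M s Ns).reduceOption.length + (adversarialArrivals H s.1 Ns).length +
        (available s.2 (adversarialArrivals H s.1 Ns)).length =
      Ns.length + s.2.length := by
  induction Ns generalizing s with
  | nil => simp [decisions, adversarialArrivals, available]
  | cons N Ns ih =>
    by_cases h : ∃ p, p ∈ s.1 ∧ H p = N
    · obtain ⟨p, -, -, h1, h2⟩ := onlineStep_of_exists (M := M) h
      obtain ⟨u, hu⟩ := partner_isSome (hM p)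
      have := ih (s.1.erase p, s.2)
      rw [decisions, h1, h2, hu, List.reduceOption_cons_of_some]
      simp only [List.length_cons] at this ⊢
      omega
    · have h1 := onlineStep_of_not_exists (M := M) h
      have := ih (s.1, rankingStep s.2 N)
      rw [decisions, h1, adversarialArrivals_of_not_exists h, available_cons]
      rcases hf : s.2.find? (fun u => decide (u ∈ N)) with _ | u
      · rw [rankingStep_of_eq_none hf] at this ⊢
        rw [List.reduceOption_cons_of_none]
        simp only [List.length_cons] at this ⊢
        omega
      · have hu := List.mem_of_find?_eq_some hf
        have hl := List.length_erase_of_mem hu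
        have hp := List.length_pos_of_mem hu
        rw [rankingStep_of_eq_some hf] at this ⊢
        rw [List.reduceOption_cons_of_some]
        simp only [List.length_cons] at this ⊢
        omega

/-- As neighbourhoods, the arrivals are the predicted nodes and those treated as adversarial. -/
theorem adversarialArrivals_add (s : Finset P) (Ns : List (Finset U))
    (h : s.val.map H ≤ (Ns : Multiset (Finset U))) :
    (adversarialArrivals H s Ns : Multiset (Finset U)) + s.val.map H = Ns := by
  induction Ns generalizing s with
  | nil =>
    have : s.val.map H = 0 := le_antisymm h (Multiset.zero_le _)
    rw [this]
    rfl
  | cons N Ns ih =>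
    by_cases hN : ∃ p, p ∈ s ∧ H p = N
    · obtain ⟨p, hp, hpN, -, h2⟩ := onlineStep_of_exists (M := ∅) (s := (s, [])) hN
      have h3 : s.val.map H = N ::ₘ (s.erase p).val.map H := by
        rw [Finset.erase_val, ← hpN, ← Multiset.map_cons, Multiset.cons_erase hp]
      rw [h3, ← Multiset.cons_coe, Multiset.cons_le_cons_iff] at h
      rw [h2, h3, Multiset.add_cons, ih _ h, Multiset.cons_coe]
    · have h1 : N ∉ s.val.map H := fun h' => hN (by simpa using h')
      rw [← Multiset.cons_coe, Multiset.le_cons_of_notMem h1] at h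
      rw [adversarialArrivals_of_not_exists hN, ← Multiset.cons_coe, Multiset.cons_add, ih _ h,
        Multiset.cons_coe]

theorem forall₂_decisions (hM : IsMatching H M) (s : Finset P × List U) (Ns : List (Finset U)) :
    List.Forall₂ (fun N o => ∀ u, o = some u → u ∈ N) Ns (decisions H M s Ns) := by
  induction Ns generalizing s with
  | nil => exact List.Forall₂.nil
  | cons N Ns ih =>
    refine List.Forall₂.cons ?_ (ih _)
    intro u hu
    by_cases h : ∃ p, p ∈ s.1 ∧ H p = N
    · obtain ⟨p, -, hp, h1, -⟩ := onlineStep_of_exists (M := M) h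
      rw [h1] at hu
      exact hp ▸ hM.1 _ (partner_eq_some hu)
    · rw [onlineStep_of_not_exists h] at hu
      simpa using List.find?_some hu

theorem mem_reduceOption_decisions {s : Finset P × List U} {Ns : List (Finset U)} {u : U}
    (hu : u ∈ (decisions H M s Ns).reduceOption) :
    (∃ p ∈ s.1, (p, u) ∈ M) ∨ u ∈ s.2 := by
  induction Ns generalizing s with
  | nil => simp [decisions, List.reduceOption] at hu
  | cons N Ns ih =>
    rw [List.reduceOption_mem_iff, decisions, List.mem_cons, ← List.reduceOption_mem_iff] at hu
    by_cases h : ∃ p, p ∈ s.1 ∧ H p = N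
    · obtain ⟨p, hp, -, h1, -⟩ := onlineStep_of_exists (M := M) h
      rw [h1] at hu
      rcases hu with hu | hu
      · exact Or.inl ⟨p, hp, partner_eq_some hu.symm⟩
      · exact (ih hu).imp_left fun ⟨q, hq, h⟩ => ⟨q, Finset.mem_of_mem_erase hq, h⟩
    · rw [onlineStep_of_not_exists h] at hu
      rcases hu with hu | hu
      · exact Or.inr (List.mem_of_find?_eq_some hu.symm)
      · exact (ih hu).imp_right fun h => (rankingStep_sublist _ _).subset h

/-- `M` and the reserve use disjoint offline nodes; a predicted node is erased once seen, a reserved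
one once used. -/
theorem nodup_reduceOption_decisions (hM : IsMatching H M) {s : Finset P × List U}
    (hs : s.2.Nodup) (hd : ∀ p u, (p, u) ∈ M → u ∉ s.2) (Ns : List (Finset U)) :
    (decisions H M s Ns).reduceOption.Nodup := by
  induction Ns generalizing s with
  | nil => simp [decisions, List.reduceOption]
  | cons N Ns ih =>
    rw [decisions]
    by_cases h : ∃ p, p ∈ s.1 ∧ H p = N
    · obtain ⟨p, hp, -, h1, -⟩ := onlineStep_of_exists (M := M) h
      rw [h1]
      have h2 := ih (s := (s.1.erase p, s.2)) hs hd
      rcases h3 : partner M p with _ | u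
      · rwa [List.reduceOption_cons_of_none]
      · rw [List.reduceOption_cons_of_some, List.nodup_cons]
        refine ⟨fun hu => ?_, h2⟩
        have h4 := partner_eq_some h3
        rcases mem_reduceOption_decisions hu with ⟨q, hq, h5⟩ | h5
        · have h6 := hM.2.2 (Finset.mem_coe.2 h4) (Finset.mem_coe.2 h5) rfl
          exact Finset.ne_of_mem_erase hq (congrArg Prod.fst h6).symm
        · exact hd p u h4 h5
    · rw [onlineStep_of_not_exists h]
      have hsub := rankingStep_sublist s.2 N
      have h2 := ih (s := (s.1, rankingStep s.2 N)) (hs.sublist hsub)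
        fun p u hpu hu => hd p u hpu (hsub.subset hu)
      rcases h3 : s.2.find? (fun u => decide (u ∈ N)) with _ | u
      · rwa [List.reduceOption_cons_of_none]
      · rw [List.reduceOption_cons_of_some, List.nodup_cons]
        refine ⟨fun hu => ?_, h2⟩
        rcases mem_reduceOption_decisions hu with ⟨q, -, h5⟩ | h5
        · exact hd q u h5 (List.mem_of_find?_eq_some h3)
        · rw [rankingStep_of_eq_some h3] at h5
          exact hs.not_mem_erase h5

theorem legal_onlinePhase {us R : List U} (hM : IsMatching (remove H us) M) (hus : us.Nodup)
    (hR : R.Perm us) : Legal (onlinePhase H M R) := by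
  have h1 : ∀ e ∈ M, e.2 ∈ H e.1 ∧ e.2 ∉ us := fun e he => by simpa [remove] using hM.1 e he
  have hM' : IsMatching H M := ⟨fun e he => (h1 e he).1, hM.2⟩
  intro Ns
  rw [run_onlinePhase]
  exact ⟨forall₂_decisions hM' _ Ns, nodup_reduceOption_decisions hM' (hR.nodup_iff.2 hus)
    (fun p u hpu hu => (h1 _ hpu).2 (hR.mem_iff.1 hu)) Ns⟩

/-- This gives names of adversarial nodes back to the arrivals treated as adversarial, which may be
predicted twins. -/
theorem exists_list_map_eq {α β : Type*} {f : α → β} {l : List β} {m : Multiset α}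
    (h : m.map f = l) : ∃ l' : List α, (l' : Multiset α) = m ∧ l'.map f = l := by
  classical
  induction l generalizing m with
  | nil => exact ⟨[], (Multiset.map_eq_zero.1 h).symm, rfl⟩
  | cons b l ih =>
    obtain ⟨a, ha, hab, h1⟩ := (Multiset.map_eq_cons f m l b).2 h
    obtain ⟨l', hl', h2⟩ := ih h1
    refine ⟨a :: l', ?_, by rw [List.map_cons, hab, h2]⟩
    rw [← Multiset.cons_coe, hl', Multiset.cons_erase ha]

theorem mem_support_randomOrder {us R : List U} (h : R ∈ (randomOrder us).support) :
    R.Perm us := by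
  obtain ⟨π, -, rfl⟩ := (PMF.mem_support_map_iff _ _ _).1 h
  have := Equiv.Perm.ofFn_comp_perm π us.get
  rwa [List.ofFn_get] at this

end OnlinePhase

/-- With `x = d / (d + 1)`, the inequality `x ^ (d + 1) ≤ 1/e` reduces the claim to `(2 d + 1) / e ≤
d`. This holds for `d ≥ 2` since `e ≥ 2.5`, but fails for `d ≤ 1`, where the claim is checked
directly. -/
theorem mul_one_sub_exp_le (d : ℕ) :
    (d : ℝ) * (1 - 1 / Real.exp 1) ≤ (d + 1) * (1 - ((d : ℝ) / (d + 1)) ^ d) := by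
  have he : (2.5 : ℝ) ≤ Real.exp 1 := by linarith [Real.exp_one_gt_d9]
  have he0 : 0 < Real.exp 1 := Real.exp_pos 1
  rcases Nat.lt_or_ge d 2 with hd | hd
  · interval_cases d
    · simp
    · have : 0 < 1 / Real.exp 1 := by positivity
      norm_num at this ⊢
      linarith
  · have hd' : (2 : ℝ) ≤ d := by exact_mod_cast hd
    set x : ℝ := (d : ℝ) / (d + 1) with hx
    have hx0 : 0 ≤ x := by positivity
    have h1 : x ≤ Real.exp (-(1 / (d + 1 : ℝ))) := by
      refine le_trans (le_of_eq ?_) (Real.add_one_le_exp _)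
      rw [hx]
      field_simp
      ring
    have h2 : x ^ (d + 1) ≤ 1 / Real.exp 1 := by
      refine (pow_le_pow_left₀ hx0 h1 _).trans (le_of_eq ?_)
      rw [← Real.exp_nat_mul, one_div (Real.exp 1), ← Real.exp_neg]
      congr 1
      push_cast
      field_simp
    have h3 : x ^ d * d ≤ 1 / Real.exp 1 * (d + 1) := by
      have : x ^ d * d = x ^ (d + 1) * (d + 1) := by
        rw [pow_succ, mul_assoc, hx, div_mul_cancel₀ _ (by positivity)]
      rw [this]
      gcongr
    have h4 : 1 / Real.exp 1 * (2 * d + 1) ≤ d := by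
      rw [div_mul_eq_mul_div, one_mul, div_le_iff₀ he0]
      nlinarith
    have h5 : d * ((d : ℝ) * (1 - 1 / Real.exp 1)) ≤ d * ((d + 1) * (1 - x ^ d)) := by
      have : (d + 1) * (x ^ d * d) ≤ (d + 1) * (1 / Real.exp 1 * (d + 1)) := by gcongr
      nlinarith
    exact le_of_mul_le_mul_left h5 (by linarith)

/-! ### The competitive ratio. -/

section Competitive

variable {U P A : Type*} [Fintype U] [DecidableEq U] [Fintype P] [DecidableEq P] [Fintype A]

theorem coe_map_eq_of_isArrivalOrder {G : P ⊕ A → Finset U} {order : List (P ⊕ A)}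
    (ho : IsArrivalOrder order) :
    ((order.map G : List (Finset U)) : Multiset (Finset U)) =
      Finset.univ.val.map (fun a => G (Sum.inr a)) +
        Finset.univ.val.map (predictedGraph G) := by
  classical
  have h1 : (order : Multiset (P ⊕ A)) = Finset.univ.val :=
    (Multiset.Nodup.ext (Multiset.coe_nodup.2 ho.1) Finset.univ.nodup).2 fun v => by
      simp [ho.2 v]
  rw [← Multiset.map_coe, h1, ← Finset.univ_disjSum_univ, Finset.val_disjSum, Multiset.disjSum,
    Multiset.map_add, Multiset.map_map, Multiset.map_map, add_comm]
  rfl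

/-- The expected number of matched online nodes, for the given removed offline nodes. -/
theorem le_expect_matchedCount {G : P ⊕ A → Finset U} (m : P ⊕ A ≃ U) (hm : ∀ v, m v ∈ G v)
    {order : List (P ⊕ A)} (ho : IsArrivalOrder order) {us : List U} (hus : us.Nodup)
    (hlen : us.length = Fintype.card A) {M : Finset (P × U)} (hM : ∀ p, ∃ u, (p, u) ∈ M) :
    (Fintype.card P : ℝ≥0∞) +
        (us.countP (· ∈ Finset.univ.image fun a => m (Sum.inr a)) : ℝ≥0∞) *
          ENNReal.ofReal (1 - ((Fintype.card A : ℝ) / (Fintype.card A + 1)) ^ Fintype.card A) ≤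
      expect (randomOrder us) fun R =>
        (matchedCount (onlinePhase (predictedGraph G) M R) (order.map G) : ℝ≥0∞) := by
  classical
  set T := Finset.univ.image fun a => m (Sum.inr a) with hT
  set adv := adversarialArrivals (predictedGraph G) Finset.univ (order.map G) with hadv
  have h1 := coe_map_eq_of_isArrivalOrder (G := G) ho
  have h2 : (adv : Multiset (Finset U)) = Finset.univ.val.map fun a => G (Sum.inr a) := by
    have := adversarialArrivals_add (H := predictedGraph G) Finset.univ (order.map G)
      (h1 ▸ Multiset.le_add_left _ _)
    rw [h1] at this
    exact add_right_cancel this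
  obtain ⟨l, hl, hladv⟩ := exists_list_map_eq h2.symm
  have hadvlen : adv.length = Fintype.card A := by
    rw [← Multiset.coe_card, h2, Multiset.card_map]
    rfl
  have horder : (order.map G).length = Fintype.card A + Fintype.card P := by
    rw [← Multiset.coe_card, h1, Multiset.card_add, Multiset.card_map, Multiset.card_map]
    rfl
  have h3 : ∀ u ∈ T, ∃ i, ∃ h : i < l.length, m (Sum.inr l[i]) = u := by
    intro u hu
    obtain ⟨a, -, rfl⟩ := Finset.mem_image.1 hu
    have ha : a ∈ l := by
      rw [← Multiset.mem_coe, hl]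
      exact Finset.mem_univ a
    obtain ⟨i, hi, rfl⟩ := List.getElem_of_mem ha
    exact ⟨i, hi, rfl⟩
  choose! a ha hau using h3
  have h4 := le_expect_ranking hus (Ns := adv) (S := us.toFinset.filter (· ∈ T))
    -- RANKING is compared with the edges of `m` at the reserved nodes of `T`; `a u` is the position
    -- of the partner of `u` in the relabelled list `l`.
    (fun u hu => List.mem_toFinset.1 (Finset.mem_filter.1 hu).1) (a := a)
    (fun u hu v hv huv => by
      have hu' := (Finset.mem_filter.1 hu).2
      have hv' := (Finset.mem_filter.1 hv).2
      rw [← hau u hu', ← hau v hv']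
      simp only [huv])
    (fun u hu => by
      have hu' := (Finset.mem_filter.1 hu).2
      have h5 := ha u hu'
      refine ⟨by rw [← hladv, List.length_map]; exact h5, ?_⟩
      have h6 := hm (Sum.inr l[a u])
      rw [hau u hu'] at h6
      simpa only [← hladv, List.getElem_map] using h6)
  have h5 : (us.toFinset.filter (· ∈ T)).card = us.countP (· ∈ T) := by
    rw [List.countP_eq_length_filter, ← List.toFinset_card_of_nodup (hus.filter _),
      List.toFinset_filter]
    simp
  rw [h5, hlen] at h4
  rw [← expect_const (randomOrder us) (Fintype.card P : ℝ≥0∞)]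
  refine (add_le_add_right h4 _).trans ?_
  rw [← expect_add]
  refine expect_mono fun R hR => ?_
  have h6 := (mem_support_randomOrder hR).length_eq
  -- With `d` reserved nodes, `d` arrivals treated as adversarial and `p + d` arrivals in all,
  -- exactly `p + (d - |available|)` nodes are matched.
  have h7 := length_reduceOption_decisions (H := predictedGraph G) hM (Finset.univ, R) (order.map G)
  have h8 := (available_sublist R adv).length_le
  rw [← run_onlinePhase, ← matchedCount] at h7
  rw [← Nat.cast_add]
  refine Nat.cast_le.2 ?_
  simp only [← hadv] at h7
  omega

end Competitive

end SemiOnline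

theorem mainTheorem6 {U P : Type*} [Fintype U] [DecidableEq U] [Fintype P] [DecidableEq P]
    (H : P → Finset U) (M : List U → Finset (P × U))
    (hM : ∀ us : List U, SemiOnline.IsMaximumMatching (SemiOnline.remove H us) (M us)) :
    (∀ D ∈ (SemiOnline.iterativeSampling H M).support, SemiOnline.Legal D) ∧
      ∀ (A : Type*) [Fintype A] (G : P ⊕ A → Finset U),
        SemiOnline.predictedGraph G = H → SemiOnline.HasPerfectMatching G →
          ∀ order : List (P ⊕ A), SemiOnline.IsArrivalOrder order →
            ENNReal.ofReal
                ((1 - SemiOnline.delta G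
                    + SemiOnline.delta G ^ 2 / 2 * (1 - 1 / Real.exp 1))
                  * (SemiOnline.nu G : ℝ))
              ≤ SemiOnline.expectedMatched (SemiOnline.iterativeSampling H M)
                  (order.map G) := by
  classical
  open SemiOnline in
  constructor
  · intro D hD
    obtain ⟨⟨_, R⟩, hMR, rfl⟩ := (PMF.mem_support_map_iff _ _ _).1 hD
    obtain ⟨us, hus, hMR⟩ := (PMF.mem_support_bind_iff _ _ _).1 hMR
    obtain ⟨R', hR, h⟩ := (PMF.mem_support_map_iff _ _ _).1 hMR
    cases h
    exact legal_onlinePhase (hM us).1 (nodup_of_mem_support_reserve List.nodup_nil hus)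
      (mem_support_randomOrder hR)
  · rintro A _ G rfl ⟨m, hm⟩ order ho
    set p := Fintype.card P with hp
    set d := Fintype.card A with hd
    set T := Finset.univ.image fun a => m (Sum.inr a) with hT
    have hn : Fintype.card U = p + d := by
      rw [← Fintype.card_congr m, Fintype.card_sum]
    have hG : nu G = p + d := by
      rw [nu_eq_card_iff.2 ⟨m, m.injective, hm⟩, Fintype.card_sum]
    have hg : Function.Injective fun q => m (Sum.inl q) :=
      m.injective.comp Sum.inl_injective
    have hgH : ∀ q, m (Sum.inl q) ∈ predictedGraph G q := fun q => hm _
    have hTg : ∀ u, u ∉ T → u ∈ Set.range fun q => m (Sum.inl q) := by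
      intro u hu
      rcases h : m.symm u with q | a
      · exact ⟨q, (m.symm_apply_eq.1 h).symm⟩
      · exact absurd (Finset.mem_image.2 ⟨a, Finset.mem_univ a, (m.symm_apply_eq.1 h).symm⟩) hu
    have hH : nu (predictedGraph G) = p := nu_eq_card_iff.2 ⟨_, hg, hgH⟩
    have hH' : nu (remove (predictedGraph G) []) = p := by
      have h : remove (predictedGraph G) [] = predictedGraph G := by
        ext
        simp [remove]
      rw [h, hH]
    have hlen : ([] : List U).length + (Fintype.card U - p) = Fintype.card U - p := by simp
    set c := ENNReal.ofReal (1 - ((d : ℝ) / (d + 1)) ^ d) with hc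
    have h1 : ∀ us ∈ (reserve (predictedGraph G) (Fintype.card U - p) []).support,
        (p : ℝ≥0∞) + (us.countP (· ∈ T) : ℝ≥0∞) * c ≤ expect (randomOrder us) fun R =>
          (matchedCount (onlinePhase (predictedGraph G) (M us) R) (order.map G) : ℝ≥0∞) := by
      intro us hus
      have h2 := of_mem_support_reserve hg hgH hTg hH' hlen hus
      exact le_expect_matchedCount m hm ho (nodup_of_mem_support_reserve List.nodup_nil hus)
        (by omega) ((hM us).1.exists_mem_of_card_eq ((hM us).2.trans h2.2))
    have h2 : expectedMatched (iterativeSampling (predictedGraph G) M) (order.map G) =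
        expect (reserve (predictedGraph G) (Fintype.card U - p) []) fun us =>
          expect (randomOrder us) fun R =>
            (matchedCount (onlinePhase (predictedGraph G) (M us) R) (order.map G) : ℝ≥0∞) := by
      change expect _ _ = _
      rw [iterativeSampling, expect_map, preprocess, expect_bind]
      simp only [expect_map]
      rfl
    rw [h2]
    refine le_trans ?_ (expect_mono h1)
    rw [expect_add, expect_const, expect_mul_const]
    have h3 := le_expect_countP_reserve hg hgH hTg hH' hlen
    rw [List.countP_nil, Nat.cast_zero, zero_add] at h3
    refine le_trans ?_ (add_le_add_right (mul_le_mul_left h3 c) _)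
    -- In the empty graph `δ` is a junk value, but the bound is multiplied by `ν(G) = 0`.
    rcases Nat.eq_zero_or_pos (p + d) with h0 | h0
    · rw [hG, h0]
      simp
    have h0' : (0 : ℝ) < p + d := by exact_mod_cast h0
    have hsum : ((∑ j ∈ Finset.range (Fintype.card U - p + 1), j : ℕ) : ℝ) = d * (d + 1) / 2 := by
      have h4 := Finset.sum_range_id_mul_two (Fintype.card U - p + 1)
      rw [show Fintype.card U - p = d by omega] at h4 ⊢
      rw [Nat.add_sub_cancel] at h4
      have h5 : ((∑ j ∈ Finset.range (d + 1), j : ℕ) : ℝ) * 2 = (d + 1) * d := by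
        exact_mod_cast h4
      linarith
    have hδ : delta G = d / (p + d) := by
      rw [delta, hH, hG]
      push_cast
      field_simp
      ring
    rw [← ENNReal.ofReal_natCast p, ← ENNReal.ofReal_natCast (∑ j ∈ _, j),
      ← ENNReal.ofReal_natCast (Fintype.card U), hsum, hn, Nat.cast_add,
      ← ENNReal.ofReal_div_of_pos h0', hc, ← ENNReal.ofReal_mul (by positivity),
      ← ENNReal.ofReal_add (by positivity)]
    · refine ENNReal.ofReal_le_ofReal ?_
      rw [hδ, hG]
      have h4 := mul_one_sub_exp_le d
      have h5 : (d : ℝ) / 2 / (p + d) * (d * (1 - 1 / Real.exp 1)) ≤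
          d / 2 / (p + d) * ((d + 1) * (1 - ((d : ℝ) / (d + 1)) ^ d)) := by gcongr
      refine le_trans (le_of_eq ?_) ((add_le_add_right h5 (p : ℝ)).trans (le_of_eq ?_))
      · push_cast
        field_simp
        ring
      · ring
    · refine mul_nonneg (by positivity) (sub_nonneg.2 (pow_le_one₀ (by positivity) ?_))
      rw [div_le_one (by positivity)]
      linarith
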